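/- Let $d\ge 0$, and let $P\subset\mathbb{R}^d$ be a $d$-dimensional reflexive polytope; that is, $P$ is the convex hull of finitely many points of $\mathbb{Z}^d$, has dimension $d$, and its dual $P^\vee=\{u\in\mathbb{R}^d \mid \langle u,v\rangle\le 1 \text{ for all } v\in P\}$ is also the convex hull of finitely many points of $\mathbb{Z}^d$. Let $f_{d-1}(P)$ denote the number of facets of $P$, i.e. of its $(d-1)$-dimensional faces (the empty face having dimension $-1$), which is finite. Then $$f_{d-1}(P)\le d!\,\mathrm{vol}(P),$$ where $\mathrm{vol}$ is the Lebesgue measure on $\mathbb{R}^d$. -/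

import Mathlib

open scoped Nat

noncomputable section

/-- The standard lattice of integer points in Euclidean `d`-space. -/
def latticePoints (d : ℕ) : Set (EuclideanSpace ℝ (Fin d)) :=
  {x | ∀ i, ∃ n : ℤ, x i = n}

/-- A convex lattice polytope: the convex hull of finitely many integer points. -/
def IsLatticePolytope {d : ℕ} (P : Set (EuclideanSpace ℝ (Fin d))) : Prop :=
  ∃ S : Finset (EuclideanSpace ℝ (Fin d)),
    (S : Set (EuclideanSpace ℝ (Fin d))) ⊆ latticePoints d ∧
      P = convexHull ℝ (S : Set (EuclideanSpace ℝ (Fin d)))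

/-- The dual `{u | ⟨u, v⟩ ≤ 1 for all v ∈ P}`. -/
def dualPolytope {d : ℕ} (P : Set (EuclideanSpace ℝ (Fin d))) :
    Set (EuclideanSpace ℝ (Fin d)) :=
  {u | ∀ v ∈ P, inner ℝ u v ≤ 1}

/-- A convex lattice polytope is reflexive if its dual is a lattice polytope as well.
(For full-dimensional `P` the dual is bounded exactly when the origin is an interior point of `P`,
so this condition contains that one.) -/
def IsReflexive {d : ℕ} (P : Set (EuclideanSpace ℝ (Fin d))) : Prop :=
  IsLatticePolytope P ∧ IsLatticePolytope (dualPolytope P)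

open Classical in
/-- The dimension of the affine hull of a set; the empty set has dimension `-1`. -/
def affineDim {d : ℕ} (F : Set (EuclideanSpace ℝ (Fin d))) : ℤ :=
  if F = ∅ then -1 else (Module.finrank ℝ (vectorSpan ℝ F) : ℤ)

/-- The `k`-dimensional faces of `P`. A face is the empty set or the set of maximizers on `P` of a
linear functional (`P` itself included, from the zero functional). -/
def facesOfDim {d : ℕ} (P : Set (EuclideanSpace ℝ (Fin d))) (k : ℤ) :
    Set (Set (EuclideanSpace ℝ (Fin d))) :=
  {F | IsExposed ℝ P F ∧ affineDim F = k}

/-- The face number `f_k(P)`: the number of `k`-dimensional faces of `P`. -/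
def faceNumber {d : ℕ} (P : Set (EuclideanSpace ℝ (Fin d))) (k : ℤ) : ℕ :=
  (facesOfDim P k).ncard

end

open MeasureTheory Module

noncomputable section

/-! A bounded dual forces the origin into the interior of `P`, so each facet lies on a hyperplane `m
= 1` with `m ≤ 1` on `P`, and it contains `d` linearly independent lattice points. Together with the
origin these span a simplex inside `P` of volume `|det| / d!`, which is at least `1 / d!` because
the determinant is a nonzero integer (`le_volume_image_cornerSimplex`). Simplices of two facets meet
only where their functionals agree, a null set (`aedisjoint_image_cornerSimplex`), so the volumes
add up. -/

/-! ### Volumes of lattice simplices -/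

/-- The corner simplex `{x | 0 ≤ xᵢ, ∑ xᵢ < 1}`. -/
def cornerSimplex (d : ℕ) : Set (EuclideanSpace ℝ (Fin d)) :=
  {x | (∀ i, 0 ≤ x i) ∧ ∑ i, x i < 1}

theorem measurableSet_cornerSimplex (d : ℕ) : MeasurableSet (cornerSimplex d) := by
  unfold cornerSimplex
  simp only [measurableSet_setOfPred]
  fun_prop

/-- The linear map sending the standard basis to `v`. -/
def columnMap {d : ℕ} (v : Fin d → EuclideanSpace ℝ (Fin d)) :
    EuclideanSpace ℝ (Fin d) →ₗ[ℝ] EuclideanSpace ℝ (Fin d) :=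
  (EuclideanSpace.basisFun (Fin d) ℝ).toBasis.constr ℝ v

theorem columnMap_apply {d : ℕ} (v : Fin d → EuclideanSpace ℝ (Fin d))
    (x : EuclideanSpace ℝ (Fin d)) : columnMap v x = ∑ i, x i • v i := by
  simp [columnMap, Basis.constr_apply_fintype]

theorem columnMap_single {d : ℕ} (v : Fin d → EuclideanSpace ℝ (Fin d)) (j : Fin d) :
    columnMap v ((EuclideanSpace.basisFun (Fin d) ℝ).toBasis j) = v j := by
  simp only [columnMap, Basis.constr_basis]

theorem det_columnMap {d : ℕ} (v : Fin d → EuclideanSpace ℝ (Fin d)) :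
    LinearMap.det (columnMap v) = (Matrix.of fun i j => v j i).det := by
  rw [← LinearMap.det_toMatrix (EuclideanSpace.basisFun (Fin d) ℝ).toBasis]
  congr 1
  ext i j
  rw [LinearMap.toMatrix_apply, columnMap_single]
  simp

theorem volume_crossPolytope (d : ℕ) :
    volume {x : EuclideanSpace ℝ (Fin d) | ∑ i, |x i| < 1} = ENNReal.ofReal (2 ^ d / d !) := by
  rcases Nat.eq_zero_or_pos d with rfl | hd
  · simp [volume_euclideanSpace_eq_dirac]
  have : Nonempty (Fin d) := ⟨⟨0, hd⟩⟩
  have h := volume_sum_rpow_lt_one (Fin d) (p := 1) le_rfl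
  have hm : MeasurableSet {x : Fin d → ℝ | ∑ i, |x i| < 1} := by
    simp only [measurableSet_setOfPred]; fun_prop
  have h2 := (PiLp.volume_preserving_ofLp (Fin d)).measure_preimage hm.nullMeasurableSet
  have h3 : Real.Gamma (1 + 1) = 1 := by
    have := Real.Gamma_nat_eq_factorial 1
    norm_num at this ⊢
  simp only [Real.rpow_one, Fintype.card_fin, div_one, Real.Gamma_nat_eq_factorial, h3,
    mul_one] at h
  rw [← h, ← h2]
  rfl

/-- The `2 ^ d` sign reflections of the simplex cover the cross-polytope, and each preserves volume.
Overlaps are harmless for a lower bound. -/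
theorem le_volume_cornerSimplex (d : ℕ) :
    ENNReal.ofReal (1 / d !) ≤ volume (cornerSimplex d) := by
  let sgn : (Fin d → Bool) → Fin d → ℝ := fun ε i => if ε i then 1 else -1
  let flip : (Fin d → Bool) → EuclideanSpace ℝ (Fin d) →ₗ[ℝ] EuclideanSpace ℝ (Fin d) :=
    fun ε => columnMap fun i => EuclideanSpace.single i (sgn ε i)
  have hflip : ∀ ε x i, flip ε x i = x i * sgn ε i := by
    intro ε x i
    simp [flip, columnMap_apply, Pi.single_apply]
  have hdet : ∀ ε, |LinearMap.det (flip ε)| = 1 := by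
    intro ε
    have : (Matrix.of fun i j => (EuclideanSpace.single j (sgn ε j) : EuclideanSpace ℝ (Fin d)) i)
        = Matrix.diagonal (sgn ε) := by
      ext i j
      by_cases h : i = j
      · subst h; simp
      · simp [h]
    rw [det_columnMap, this, Matrix.det_diagonal, Finset.abs_prod]
    refine Finset.prod_eq_one fun i _ => ?_
    simp only [sgn]
    split_ifs <;> simp
  have hcover : {x : EuclideanSpace ℝ (Fin d) | ∑ i, |x i| < 1} ⊆
      ⋃ ε, flip ε '' cornerSimplex d := by
    intro x hx
    refine Set.mem_iUnion.2 ⟨fun i => decide (0 ≤ x i), WithLp.toLp 2 fun i => |x i|,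
      ⟨fun i => abs_nonneg _, hx⟩, ?_⟩
    ext i
    rw [hflip]
    simp only [sgn, decide_eq_true_eq]
    split_ifs with h
    · simp [abs_of_nonneg h]
    · simp [abs_of_neg (not_le.1 h)]
  have hle : ENNReal.ofReal (2 ^ d / d !) ≤ 2 ^ d * volume (cornerSimplex d) := by
    rw [← volume_crossPolytope]
    refine (measure_mono hcover).trans ((measure_iUnion_fintype_le _ _).trans_eq ?_)
    simp [Measure.addHaar_image_linearMap, hdet]
  rw [div_eq_mul_one_div, ENNReal.ofReal_mul (by positivity), ENNReal.ofReal_pow (by norm_num),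
    ENNReal.ofReal_ofNat] at hle
  exact (ENNReal.mul_le_mul_iff_right (by positivity) (by finiteness)).1 hle

theorem one_le_abs_det_columnMap {d : ℕ} {v : Fin d → EuclideanSpace ℝ (Fin d)}
    (hv : ∀ i, v i ∈ latticePoints d) (hli : LinearIndependent ℝ v) :
    1 ≤ |LinearMap.det (columnMap v)| := by
  have hne : LinearMap.det (columnMap v) ≠ 0 := by
    have hker : LinearMap.ker (columnMap v) = ⊥ := by
      rw [LinearMap.ker_eq_bot']
      intro x hx
      rw [columnMap_apply] at hx
      ext i
      exact Fintype.linearIndependent_iff.1 hli x hx i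
    intro h
    exact (LinearMap.bot_lt_ker_of_det_eq_zero h).ne' hker
  choose n hn using hv
  have hcast : LinearMap.det (columnMap v) = (((Matrix.of fun i j => n j i).det : ℤ) : ℝ) := by
    rw [det_columnMap, ← eq_intCast (Int.castRingHom ℝ), RingHom.map_det]
    congr 1
    ext i j
    simp [hn]
  rw [hcast] at hne ⊢
  exact_mod_cast Int.one_le_abs (by exact_mod_cast hne)

theorem le_volume_image_cornerSimplex {d : ℕ} {v : Fin d → EuclideanSpace ℝ (Fin d)}
    (hv : ∀ i, v i ∈ latticePoints d) (hli : LinearIndependent ℝ v) :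
    ENNReal.ofReal (1 / d !) ≤ volume (columnMap v '' cornerSimplex d) := by
  rw [Measure.addHaar_image_linearMap]
  refine (le_volume_cornerSimplex d).trans (le_mul_of_one_le_left' ?_)
  rw [← ENNReal.ofReal_one]
  exact ENNReal.ofReal_le_ofReal (one_le_abs_det_columnMap hv hli)

theorem nullMeasurableSet_image_cornerSimplex {d : ℕ} {v : Fin d → EuclideanSpace ℝ (Fin d)}
    (hli : LinearIndependent ℝ v) :
    NullMeasurableSet (columnMap v '' cornerSimplex d) volume := by
  have hker : Function.Injective (columnMap v) := by
    rw [← LinearMap.ker_eq_bot, LinearMap.ker_eq_bot']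
    intro x hx
    rw [columnMap_apply] at hx
    ext i
    exact Fintype.linearIndependent_iff.1 hli x hx i
  exact ((measurableSet_cornerSimplex d).image_of_continuousOn_injOn
    (columnMap v).continuous_of_finiteDimensional.continuousOn hker.injOn).nullMeasurableSet

/-! ### The origin and the facet hyperplanes -/

/-- A convex set with nonempty interior and bounded dual contains the origin in its interior. -/
theorem zero_mem_interior_of_isBounded_dualPolytope {d : ℕ} {P : Set (EuclideanSpace ℝ (Fin d))}
    (hc : Convex ℝ P) (hne : (interior P).Nonempty)
    (hb : Bornology.IsBounded (dualPolytope P)) : 0 ∈ interior P := by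
  by_contra h0
  -- A functional that is nonpositive on `P` has all its nonnegative multiples in the dual, against
  -- boundedness.
  obtain ⟨f, hf⟩ := geometric_hahn_banach_open_point hc.interior isOpen_interior h0
  rw [map_zero] at hf
  have hfP : ∀ a ∈ P, f a ≤ 0 := by
    intro a ha
    have ha' : a ∈ closure (interior P) := by
      rw [hc.closure_interior_eq_closure_of_nonempty_interior hne]
      exact subset_closure ha
    exact closure_minimal (t := {x | f x ≤ 0}) (fun x hx => (hf x hx).le)
      (isClosed_le f.continuous continuous_const) ha'
  obtain ⟨u, rfl⟩ := (InnerProductSpace.toDual ℝ (EuclideanSpace ℝ (Fin d))).surjective f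
  simp only [InnerProductSpace.toDual_apply_apply] at hf hfP
  have hu : u ≠ 0 := by
    rintro rfl
    obtain ⟨a, ha⟩ := hne
    simpa using hf a ha
  obtain ⟨C, hC⟩ := hb.exists_norm_le
  obtain ⟨n, hn⟩ := exists_nat_gt (C / ‖u‖)
  have hmem : (n : ℝ) • u ∈ dualPolytope P := by
    intro a ha
    rw [real_inner_smul_left]
    nlinarith [hfP a ha, mul_nonpos_of_nonneg_of_nonpos n.cast_nonneg (hfP a ha)]
  have := hC _ hmem
  rw [norm_smul, Real.norm_natCast] at this
  rw [div_lt_iff₀ (norm_pos_iff.2 hu)] at hn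
  linarith

theorem interior_nonempty_of_affineDim_eq {d : ℕ} {P : Set (EuclideanSpace ℝ (Fin d))}
    (hc : Convex ℝ P) (hdim : affineDim P = d) : (interior P).Nonempty := by
  unfold affineDim at hdim
  split_ifs at hdim with h
  rw [hc.interior_nonempty_iff_affineSpan_eq_top]
  have hfin : finrank ℝ (vectorSpan ℝ P) = d := by exact_mod_cast hdim
  rw [AffineSubspace.affineSpan_eq_top_iff_vectorSpan_eq_top_of_nonempty ℝ _ _
    (Set.nonempty_iff_ne_empty.2 h)]
  apply Submodule.eq_top_of_finrank_eq
  simp [hfin]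

/-- A linear functional that is nonpositive near the origin vanishes. -/
theorem eq_zero_of_forall_mem_le_zero {d : ℕ} {P : Set (EuclideanSpace ℝ (Fin d))}
    (h0 : 0 ∈ interior P) (l : StrongDual ℝ (EuclideanSpace ℝ (Fin d)))
    (hl : ∀ y ∈ P, l y ≤ 0) : l = 0 := by
  have hmax : IsLocalMax l 0 := by
    filter_upwards [mem_interior_iff_mem_nhds.1 h0] with y hy
    simpa using hl y hy
  exact hmax.hasFDerivAt_eq_zero l.hasFDerivAt

/-- A facet of a polytope with the origin in its interior is cut out by a hyperplane `m = 1`. -/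
theorem exists_facet_functional {d : ℕ} {P F : Set (EuclideanSpace ℝ (Fin d))}
    (h0 : 0 ∈ interior P) (hdim : affineDim P = d) (hF : F ∈ facesOfDim P ((d : ℤ) - 1)) :
    ∃ m : StrongDual ℝ (EuclideanSpace ℝ (Fin d)), (∀ y ∈ P, m y ≤ 1) ∧ F = {x ∈ P | m x = 1} := by
  obtain ⟨hex, hFd⟩ := hF
  rcases F.eq_empty_or_nonempty with rfl | hne
  -- The empty face is a facet only for `d = 0`; the zero functional never equals `1`.
  · exact ⟨0, by simp, by simp⟩
  obtain ⟨l, hl⟩ := hex hne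
  obtain ⟨x, hx⟩ := hne
  have hx' := hx
  rw [hl] at hx'
  obtain ⟨hxP, hmax⟩ := hx'
  -- A maximum of `0` would force `l = 0`, making `F` all of `P`, of the wrong dimension.
  have hpos : 0 < l x := by
    have hnn : 0 ≤ l x := by simpa using hmax 0 (interior_subset h0)
    refine hnn.lt_of_ne fun hzero => ?_
    have hl0 : l = 0 := eq_zero_of_forall_mem_le_zero h0 l fun y hy => hzero ▸ hmax y hy
    have hFP : F = P := by rw [hl, hl0]; simp
    rw [hFP] at hFd
    omega
  refine ⟨(l x)⁻¹ • l, fun y hy => ?_, ?_⟩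
  · simpa [inv_mul_le_iff₀ hpos] using hmax y hy
  · rw [hl]
    ext y
    simp only [Set.mem_ofPred_eq, smul_apply, smul_eq_mul,
      inv_mul_eq_one₀ hpos.ne']
    exact and_congr_right fun hy => ⟨fun h => le_antisymm (h x hxP) (hmax y hy),
      fun h z hz => h ▸ hmax z hz⟩

/-! ### Lattice bases inside facets -/

/-- An exposed face of the convex hull of a finite set is the hull of the generators it contains. -/
theorem IsExposed.eq_convexHull_inter {E : Type*} [NormedAddCommGroup E] [NormedSpace ℝ E]
    {S F : Set E} (hS : S.Finite) (hF : IsExposed ℝ (convexHull ℝ S) F) :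
    F = convexHull ℝ (S ∩ F) := by
  have hconv : Convex ℝ F := hF.convex (convex_convexHull ℝ S)
  refine Set.Subset.antisymm ?_ (convexHull_min Set.inter_subset_right hconv)
  -- Krein–Milman: extreme points of the face are extreme in the hull, hence lie in `S`.
  rw [← closure_convexHull_extremePoints (hF.isCompact (hS.isCompact_convexHull ℝ)) hconv]
  refine closure_minimal (convexHull_mono fun x hx => ⟨?_, ?_⟩)
    ((hS.inter_of_left _).isClosed_convexHull ℝ)
  · exact extremePoints_convexHull_subset (hF.isExtreme.extremePoints_subset_extremePoints hx)
  · rw [closure_convexHull_extremePoints (hF.isCompact (hS.isCompact_convexHull ℝ)) hconv]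
    exact extremePoints_subset hx

/-- A set of dimension `d - 1` on a hyperplane `m = 1` spans the whole space. -/
theorem span_eq_top_of_affineDim {d : ℕ} {F : Set (EuclideanSpace ℝ (Fin d))}
    (hF : affineDim F = (d : ℤ) - 1) (m : StrongDual ℝ (EuclideanSpace ℝ (Fin d)))
    (hm : ∀ x ∈ F, m x = 1) : Submodule.span ℝ F = ⊤ := by
  unfold affineDim at hF
  apply Submodule.eq_top_of_finrank_eq
  rw [finrank_euclideanSpace_fin]
  split_ifs at hF with h
  · have : finrank ℝ (Submodule.span ℝ F) ≤ finrank ℝ (EuclideanSpace ℝ (Fin d)) :=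
      Submodule.finrank_le _
    rw [finrank_euclideanSpace_fin] at this
    omega
  obtain ⟨x, hx⟩ := Set.nonempty_iff_ne_empty.2 h
  have hle : vectorSpan ℝ F ≤ Submodule.span ℝ F := by
    rw [vectorSpan_def, Submodule.span_le]
    rintro _ ⟨a, ha, b, hb, rfl⟩
    exact Submodule.sub_mem _ (Submodule.subset_span ha) (Submodule.subset_span hb)
  have hker : vectorSpan ℝ F ≤ LinearMap.ker (m : EuclideanSpace ℝ (Fin d) →ₗ[ℝ] ℝ) := by
    rw [vectorSpan_def, Submodule.span_le]
    rintro _ ⟨a, ha, b, hb, rfl⟩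
    simp [hm a ha, hm b hb]
  -- `m` vanishes on the direction space but is `1` at `x`, so the linear span gains a dimension.
  have hlt : vectorSpan ℝ F < Submodule.span ℝ F := by
    refine lt_of_le_not_ge hle fun hge => ?_
    have : m x = 0 := hker (hge (Submodule.subset_span hx))
    simp [hm x hx] at this
  have h1 := Submodule.finrank_lt_finrank_of_lt hlt
  have h2 : finrank ℝ (Submodule.span ℝ F) ≤ finrank ℝ (EuclideanSpace ℝ (Fin d)) :=
    Submodule.finrank_le _
  rw [finrank_euclideanSpace_fin] at h2
  omega

theorem exists_linearIndependent_fin_of_span_eq_top {d : ℕ} {T : Set (EuclideanSpace ℝ (Fin d))}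
    (hT : Submodule.span ℝ T = ⊤) :
    ∃ v : Fin d → EuclideanSpace ℝ (Fin d), (∀ i, v i ∈ T) ∧ LinearIndependent ℝ v := by
  obtain ⟨b, hbT, hspan, hli⟩ := exists_linearIndependent ℝ T
  let B : Basis b ℝ (EuclideanSpace ℝ (Fin d)) := Basis.mk hli (by
    rw [Subtype.range_coe, hspan, hT])
  let e : b ≃ Fin d := B.indexEquiv (EuclideanSpace.basisFun (Fin d) ℝ).toBasis
  exact ⟨fun i => (e.symm i : EuclideanSpace ℝ (Fin d)), fun i => hbT (e.symm i).2,
    hli.comp _ e.symm.injective⟩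

theorem exists_latticeBasis_of_facet {d : ℕ} {P F : Set (EuclideanSpace ℝ (Fin d))}
    (hP : IsLatticePolytope P) (hF : F ∈ facesOfDim P ((d : ℤ) - 1))
    (m : StrongDual ℝ (EuclideanSpace ℝ (Fin d))) (hm : ∀ x ∈ F, m x = 1) :
    ∃ v : Fin d → EuclideanSpace ℝ (Fin d),
      (∀ i, v i ∈ latticePoints d ∧ v i ∈ F) ∧ LinearIndependent ℝ v := by
  obtain ⟨S, hS, rfl⟩ := hP
  have hspan : Submodule.span ℝ ((S : Set (EuclideanSpace ℝ (Fin d))) ∩ F) = ⊤ := by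
    rw [eq_top_iff, ← span_eq_top_of_affineDim hF.2 m hm, Submodule.span_le]
    nth_rw 1 [hF.1.eq_convexHull_inter S.finite_toSet]
    exact convexHull_min Submodule.subset_span (Submodule.convex _)
  obtain ⟨v, hv, hli⟩ := exists_linearIndependent_fin_of_span_eq_top hspan
  exact ⟨v, fun i => ⟨hS (hv i).1, (hv i).2⟩, hli⟩

/-! ### Packing the simplices into the polytope -/

theorem image_cornerSimplex_subset {d : ℕ} {P : Set (EuclideanSpace ℝ (Fin d))}
    (hc : Convex ℝ P) (h0 : 0 ∈ P) {v : Fin d → EuclideanSpace ℝ (Fin d)} (hv : ∀ i, v i ∈ P) :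
    columnMap v '' cornerSimplex d ⊆ P := by
  rintro _ ⟨c, ⟨hc0, hc1⟩, rfl⟩
  rw [columnMap_apply]
  -- The index `none` gives the origin the leftover weight.
  have := hc.sum_mem (t := Finset.univ) (w := fun o : Option (Fin d) => o.elim (1 - ∑ i, c i) c)
    (z := fun o => o.elim 0 v) (by rintro (_ | i) _ <;> simp [hc0, hc1.le]) (by simp)
    (by rintro (_ | i) _ <;> simp [h0, hv])
  simpa using this

/-- Cones over points of distinct facets overlap in a null set. -/
theorem aedisjoint_image_cornerSimplex {d : ℕ}
    {v w : Fin d → EuclideanSpace ℝ (Fin d)} {m n : StrongDual ℝ (EuclideanSpace ℝ (Fin d))}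
    (hmv : ∀ i, m (v i) = 1) (hnw : ∀ i, n (w i) = 1) (hmw : ∀ i, m (w i) ≤ 1)
    (hnv : ∀ i, n (v i) ≤ 1) (hmn : m ≠ n) :
    AEDisjoint volume (columnMap v '' cornerSimplex d) (columnMap w '' cornerSimplex d) := by
  have hker : LinearMap.ker ((m - n : StrongDual ℝ (EuclideanSpace ℝ (Fin d))) :
      EuclideanSpace ℝ (Fin d) →ₗ[ℝ] ℝ) ≠ ⊤ := by
    rw [Ne, LinearMap.ker_eq_top]
    intro h
    apply hmn
    ext x
    have := LinearMap.congr_fun h x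
    simpa [sub_eq_zero] using this
  refine measure_mono_null ?_ (Measure.addHaar_submodule volume _ hker)
  -- On the cone over the `a i`, `p` is the coefficient sum, which bounds `q`.
  have key : ∀ (a : Fin d → EuclideanSpace ℝ (Fin d))
      (p q : StrongDual ℝ (EuclideanSpace ℝ (Fin d))), (∀ i, p (a i) = 1) → (∀ i, q (a i) ≤ 1) →
      ∀ x ∈ columnMap a '' cornerSimplex d, q x ≤ p x := by
    rintro a p q hp hq _ ⟨c, ⟨hc, -⟩, rfl⟩
    simp only [columnMap_apply, map_sum, map_smul, smul_eq_mul, hp]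
    exact Finset.sum_le_sum fun i _ => mul_le_mul_of_nonneg_left (hq i) (hc i)
  rintro x ⟨hx, hy⟩
  have h1 := key v m n hmv hnv x hx
  have h2 := key w n m hnw hmw x hy
  simpa [sub_eq_zero] using le_antisymm h2 h1

/-- Bounding every finite family of facets also yields that there are finitely many. -/
theorem card_le_factorial_mul_volume {d : ℕ} {P : Set (EuclideanSpace ℝ (Fin d))}
    (hdim : affineDim P = d) (hP : IsLatticePolytope P) (h0 : 0 ∈ interior P)
    (t : Finset (Set (EuclideanSpace ℝ (Fin d))))
    (ht : (t : Set (Set (EuclideanSpace ℝ (Fin d)))) ⊆ facesOfDim P ((d : ℤ) - 1)) :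
    (t.card : ℝ) ≤ (d ! : ℝ) * volume.real P := by
  have hc : Convex ℝ P := by obtain ⟨S, -, rfl⟩ := hP; exact convex_convexHull ℝ _
  have hfin : volume P ≠ ⊤ := by
    obtain ⟨S, -, rfl⟩ := hP
    exact (S.finite_toSet.isCompact_convexHull ℝ).measure_ne_top
  have hex : ∀ F : t, ∃ m : StrongDual ℝ (EuclideanSpace ℝ (Fin d)),
      ∃ v : Fin d → EuclideanSpace ℝ (Fin d), (∀ y ∈ P, m y ≤ 1) ∧
      (F : Set (EuclideanSpace ℝ (Fin d))) = {x ∈ P | m x = 1} ∧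
      (∀ i, v i ∈ latticePoints d ∧ v i ∈ (F : Set (EuclideanSpace ℝ (Fin d)))) ∧
      LinearIndependent ℝ v := by
    intro F
    obtain ⟨m, hm, hFm⟩ := exists_facet_functional h0 hdim (ht F.2)
    obtain ⟨v, hv, hli⟩ := exists_latticeBasis_of_facet hP (ht F.2) m
      fun x hx => by rw [hFm] at hx; exact hx.2
    exact ⟨m, v, hm, hFm, hv, hli⟩
  choose m v hm hFm hv hli using hex
  have hvP : ∀ F i, v F i ∈ P := fun F i => by
    have := (hv F i).2
    rw [hFm] at this
    exact this.1
  have hmv : ∀ F i, m F (v F i) = 1 := fun F i => by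
    have := (hv F i).2
    rw [hFm] at this
    exact this.2
  have hsum : ∑ F : t, volume (columnMap (v F) '' cornerSimplex d) ≤ volume P := by
    rw [← measure_biUnion_finset₀]
    · exact measure_mono (Set.iUnion₂_subset fun F _ =>
        image_cornerSimplex_subset hc (interior_subset h0) (hvP F))
    · intro F _ G _ hFG
      refine aedisjoint_image_cornerSimplex (hmv F) (hmv G) (fun i => hm F _ (hvP G i))
        (fun i => hm G _ (hvP F i)) fun h => hFG ?_
      apply Subtype.ext
      rw [hFm F, hFm G, h]
    · exact fun F _ => nullMeasurableSet_image_cornerSimplex (hli F)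
  have hcard : (t.card : ENNReal) * ENNReal.ofReal (1 / d !) ≤ volume P := by
    refine le_trans ?_ hsum
    have := Finset.card_nsmul_le_sum (Finset.univ : Finset t)
      (fun F => volume (columnMap (v F) '' cornerSimplex d)) (ENNReal.ofReal (1 / d !))
      fun F _ => le_volume_image_cornerSimplex (fun i => (hv F i).1) (hli F)
    simpa using this
  have hreal := ENNReal.toReal_mono hfin hcard
  rw [ENNReal.toReal_mul, ENNReal.toReal_natCast, ENNReal.toReal_ofReal (by positivity),
    mul_one_div, div_le_iff₀ (by positivity)] at hreal
  rw [mul_comm]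
  exact hreal

end

theorem corollary3p3 (d : ℕ) (P : Set (EuclideanSpace ℝ (Fin d)))
    (hdim : affineDim P = d) (hP : IsReflexive P) :
    (facesOfDim P ((d : ℤ) - 1)).Finite ∧
      (faceNumber P ((d : ℤ) - 1) : ℝ) ≤ (d ! : ℝ) * MeasureTheory.volume.real P := by
  have hc : Convex ℝ P := by obtain ⟨S, -, rfl⟩ := hP.1; exact convex_convexHull ℝ _
  have hb : Bornology.IsBounded (dualPolytope P) := by
    obtain ⟨S, -, hS⟩ := hP.2
    rw [hS]
    exact (S.finite_toSet.isCompact_convexHull ℝ).isBounded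
  have h0 := zero_mem_interior_of_isBounded_dualPolytope hc
    (interior_nonempty_of_affineDim_eq hc hdim) hb
  have hbound := card_le_factorial_mul_volume hdim hP.1 h0
  have hfin : (facesOfDim P ((d : ℤ) - 1)).Finite := by
    by_contra hinf
    obtain ⟨N, hN⟩ := exists_nat_gt ((d ! : ℝ) * MeasureTheory.volume.real P)
    obtain ⟨t, ht, rfl⟩ := Set.Infinite.exists_subset_card_eq hinf N
    exact absurd (hbound t ht) (not_le.2 hN)
  refine ⟨hfin, ?_⟩
  rw [faceNumber, Set.ncard_eq_toFinset_card _ hfin]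
  exact hbound _ (by simp)
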